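/- Let $X$, $Y$, $Z$ be metric spaces, let $1\le\alpha<\omega_1$ be an ordinal, and let $f\colon X\times Y\to Z$ be a function such that 1. the family of $x$-sections $\{f(x,\cdot)\colon Y\to Z : x\in X\}$ has the point of equicontinuity property (PECP): for every nonempty closed set $F\subseteq Y$ there is a point $y_0\in F$ at which the family of restrictions $\{f(x,\cdot)\restriction_F : x\in X\}$ is equicontinuous; 2. for every $y\in Y$ the $y$-section $f(\cdot,y)\colon X\to Z$ is of Borel class $\alpha$. Then $f$ is of Borel class $\alpha$ on $X\times Y$. Here a map between metric spaces is of Borel class $\alpha$ if the preimage of every open set is of additive class $\alpha$, where the sets of additive (multiplicative) class $0$ are the open (closed) sets and, for $\alpha>0$, the sets of additive (multiplicative) class $\alpha$ are the countable unions (countable intersections) of sets of multiplicative (additive) classes less than $\alpha$; thus additive class $1$ means $F_\sigma$. -/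

import Mathlib

/-- Sets of additive Borel class `α` in a topological space: the open sets for `α = 0`, and the
countable unions of sets of multiplicative classes less than `α` for `α > 0`. The sets of
multiplicative class `β` enter as the complements of the sets of additive class `β`. In particular
the sets of additive class `1` are the `F_σ` sets. -/
inductive IsAdditiveClass {X : Type*} [TopologicalSpace X] : Ordinal.{0} → Set X → Prop
  | isOpen {U : Set X} (hU : IsOpen U) : IsAdditiveClass 0 U
  | iUnion_compl {α : Ordinal.{0}} {β : ℕ → Ordinal.{0}} {A : ℕ → Set X}
      (hβ : ∀ n, β n < α) (hA : ∀ n, IsAdditiveClass (β n) (A n)) :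
      IsAdditiveClass α (⋃ n, (A n)ᶜ)

/-- A map is of Borel class `α` if preimages of open sets are of additive class `α`. -/
def IsOfBorelClass {X Z : Type*} [TopologicalSpace X] [TopologicalSpace Z]
    (α : Ordinal.{0}) (g : X → Z) : Prop :=
  ∀ W : Set Z, IsOpen W → IsAdditiveClass α (g ⁻¹' W)

/-- The point of equicontinuity property (PECP) of a family `𝓕` of functions: for every nonempty
closed set `F`, the family of restrictions `f|_F`, `f ∈ 𝓕`, is equicontinuous at some point of the
subspace `F`. -/
def HasPECP {X Z : Type*} [TopologicalSpace X] [MetricSpace Z] (𝓕 : Set (X → Z)) : Prop :=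
  ∀ F : Set X, IsClosed F → F.Nonempty →
    ∃ x : F, Set.EquicontinuousAt ((fun (f : X → Z) (y : F) => f y) '' 𝓕) x

open Set Filter Topology

/-! ### Additive Borel classes. -/

namespace IsAdditiveClass

/-! Fix `ε > 0`. By PECP every nonempty closed subset of `Y` has a nonempty relatively open piece on
which all `f (x, ·)` oscillate by at most `ε`. Transfinite exhaustion partitions `Y` into such
pieces `D ξ`, differences of open sets (`exists_wellOrdered_open_cover`). Freezing `y` at a point `c
ξ` of each `D ξ` changes `f` by at most `ε`, and uniform limits preserve the class.

For the frozen map, each `D ξ` is a countable union of closed sets `E n ξ`, discrete in `ξ` for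
fixed `n` (`exists_discrete_refinement`). Preimages are thus countable unions of sets `⋃ ξ, A ξ ×ˢ E
n ξ` with `A ξ` of class `α`. These have class `α` although the `ξ` may be uncountably many:
discreteness lets the decompositions of all `A ξ` run in parallel, and `α < ω₁` leaves only
countably many lower classes to index them. -/

theorem of_zero {X : Type*} [TopologicalSpace X] {A : Set X} (h : IsAdditiveClass 0 A) :
    IsOpen A := by
  generalize hα : (0 : Ordinal.{0}) = α at h
  cases h with
  | isOpen hU => exact hU
  | iUnion_compl hβ _ =>
    subst hα
    exact absurd (hβ 0) not_lt_zero

theorem exists_iUnion_compl {X : Type*} [TopologicalSpace X] {α : Ordinal.{0}} (hα : α ≠ 0)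
    {A : Set X} (h : IsAdditiveClass α A) :
    ∃ (β : ℕ → Ordinal.{0}) (B : ℕ → Set X), (∀ n, β n < α) ∧
      (∀ n, IsAdditiveClass (β n) (B n)) ∧ A = ⋃ n, (B n)ᶜ := by
  cases h with
  | isOpen hU => exact absurd rfl hα
  | iUnion_compl hβ hA => exact ⟨_, _, hβ, hA, rfl⟩

theorem iUnion_compl_of_countable {X ι : Type*} [TopologicalSpace X] [Countable ι] [Nonempty ι]
    {α : Ordinal.{0}} {β : ι → Ordinal.{0}} {A : ι → Set X} (hβ : ∀ i, β i < α)
    (hA : ∀ i, IsAdditiveClass (β i) (A i)) : IsAdditiveClass α (⋃ i, (A i)ᶜ) := by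
  obtain ⟨e, he⟩ := exists_surjective_nat ι
  rw [← he.iUnion_comp fun i => (A i)ᶜ]
  exact iUnion_compl (fun n => hβ (e n)) fun n => hA (e n)

theorem iUnion {X : Type*} [TopologicalSpace X] {α : Ordinal.{0}} {A : ℕ → Set X}
    (hA : ∀ n, IsAdditiveClass α (A n)) : IsAdditiveClass α (⋃ n, A n) := by
  rcases eq_or_ne α 0 with rfl | hα
  · exact isOpen (isOpen_iUnion fun n => (hA n).of_zero)
  · choose β B hβ hB hAB using fun n => (hA n).exists_iUnion_compl hα
    have h : ⋃ n, A n = ⋃ p : ℕ × ℕ, (B p.1 p.2)ᶜ := by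
      rw [iUnion_prod']
      exact iUnion_congr hAB
    rw [h]
    exact iUnion_compl_of_countable (fun p => hβ p.1 p.2) fun p => hB p.1 p.2

theorem univ {X : Type*} [TopologicalSpace X] (α : Ordinal.{0}) :
    IsAdditiveClass α (Set.univ : Set X) := by
  rcases eq_or_ne α 0 with rfl | hα
  · exact isOpen isOpen_univ
  · have h := iUnion_compl (X := X) (α := α) (β := fun _ => 0) (A := fun _ => ∅)
      (fun _ => pos_iff_ne_zero.2 hα) fun _ => isOpen isOpen_empty
    rwa [compl_empty, iUnion_const] at h

/-- Over a countable ordinal, the classes of the pieces in the decomposition of the members of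
a family of sets can be chosen independently of the member. -/
theorem exists_uniform_iUnion_compl {X ι : Type*} [TopologicalSpace X] {α : Ordinal.{0}}
    (hα : α ≠ 0) {A : ι → Set X} (hA : ∀ i, IsAdditiveClass α (A i)) :
    ∃ C : Iio α × ℕ → ι → Set X, (∀ k i, IsAdditiveClass (k.1 : Ordinal.{0}) (C k i)) ∧
      ∀ i, A i = ⋃ k, (C k i)ᶜ := by
  classical
  choose β B hβ hB hAB using fun i => (hA i).exists_iUnion_compl hα
  -- Filling unused slots with `univ` is harmless: its complement adds nothing to the union.
  refine ⟨fun k i => if β i k.2 = k.1 then B i k.2 else Set.univ, fun k i => ?_, fun i => ?_⟩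
  · dsimp only
    split_ifs with h
    · exact h ▸ hB i k.2
    · exact univ _
  · ext x
    rw [hAB]
    simp only [mem_iUnion, mem_compl_iff]
    constructor
    · rintro ⟨n, hn⟩
      exact ⟨(⟨β i n, hβ i n⟩, n), by simpa using hn⟩
    · rintro ⟨k, hk⟩
      refine ⟨k.2, ?_⟩
      split_ifs at hk with h
      · exact hk
      · exact absurd (mem_univ x) hk

end IsAdditiveClass

theorem Ordinal.countable_Iio_of_lt_omega_one {α : Ordinal.{0}} (hα : α < Ordinal.omega 1) :
    Countable (Iio α) := by
  rw [← Cardinal.mk_le_aleph0_iff, Cardinal.mk_Iio_ordinal, ← Cardinal.lift_aleph0.{1, 0},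
    Cardinal.lift_le, ← Order.lt_succ_iff, Cardinal.succ_aleph0, ← Cardinal.lt_ord,
    Cardinal.ord_aleph]
  exact hα

/-! ### Gluing along discrete families. -/

/-- Sets glued from sets of additive class `α` along a discrete family of closed sets. -/
theorem IsAdditiveClass.setOf_forall_mem_imp {X Y ι : Type*} [TopologicalSpace X]
    [PseudoEMetricSpace Y] {E : ι → Set Y} (hE : ∀ i, IsClosed (E i)) (hlf : LocallyFinite E)
    (hdisj : Pairwise fun i j => Disjoint (E i) (E j)) {α : Ordinal.{0}}
    (hα : α < Ordinal.omega 1) {A : ι → Set X} (hA : ∀ i, IsAdditiveClass α (A i)) :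
    IsAdditiveClass α {p : X × Y | ∀ i, p.2 ∈ E i → p.1 ∈ A i} := by
  induction α using WellFoundedLT.induction generalizing A with
  | ind α ih =>
  rcases eq_or_ne α 0 with rfl | hα0
  · refine isOpen ?_
    have hclosed : IsClosed (⋃ i, (A i)ᶜ ×ˢ E i) := by
      refine LocallyFinite.isClosed_iUnion ?_ fun i =>
        (hA i).of_zero.isClosed_compl.prod (hE i)
      exact (hlf.preimage_continuous continuous_snd).subset fun i p hp => hp.2
    convert hclosed.isOpen_compl using 1
    ext p
    simp only [mem_ofPred_eq, mem_compl_iff, mem_iUnion, mem_prod, not_exists, not_and]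
    exact forall_congr' fun i => by tauto
  · obtain ⟨C, hC, hAC⟩ := exists_uniform_iUnion_compl hα0 hA
    obtain ⟨F, hF, -, hFU, -⟩ :=
      (hlf.isClosed_iUnion hE).isOpen_compl.exists_iUnion_isClosed
    have := Ordinal.countable_Iio_of_lt_omega_one hα
    -- Off `⋃ i, E i`, an open and hence `F_σ` set, the condition is vacuous. On it, disjointness
    -- leaves a single relevant `i`, so negating the condition for `C k` yields membership in `(C k
    -- i)ᶜ`.
    have key : {p : X × Y | ∀ i, p.2 ∈ E i → p.1 ∈ A i} =
        ⋃ k : ℕ ⊕ (Iio α × ℕ), (Sum.elim (fun n => Prod.snd ⁻¹' (F n)ᶜ)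
          (fun k => {p : X × Y | ∀ i, p.2 ∈ E i → p.1 ∈ C k i}) k)ᶜ := by
      ext ⟨x, y⟩
      have hy : (∃ n, y ∈ F n) ↔ ∀ i, y ∉ E i := by
        rw [← mem_iUnion, hFU]
        simp
      simp only [mem_ofPred_eq, mem_iUnion, Sum.exists, Sum.elim_inl, Sum.elim_inr, mem_compl_iff,
        mem_preimage, not_not, hy, hAC, not_forall]
      constructor
      · intro h
        by_cases hi : ∀ i, y ∉ E i
        · exact Or.inl hi
        · push Not at hi
          obtain ⟨i, hi⟩ := hi
          obtain ⟨k, hk⟩ := h i hi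
          exact Or.inr ⟨k, i, hi, hk⟩
      · rintro (h | ⟨k, i, hi, hk⟩) j hj
        · exact absurd hj (h j)
        · have : i = j := by
            by_contra hij
            exact (hdisj hij).le_bot ⟨hi, hj⟩
          exact ⟨k, this ▸ hk⟩
    rw [key]
    refine iUnion_compl_of_countable
      (β := Sum.elim (fun _ => 0) fun k => (k.1 : Ordinal.{0})) ?_ ?_
    · rintro (n | k)
      · exact pos_iff_ne_zero.2 hα0
      · exact k.1.2
    · rintro (n | k)
      · exact isOpen ((hF n).isOpen_compl.preimage continuous_snd)
      · exact ih k.1 k.1.2 (lt_trans k.1.2 hα) (hC k)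

/-- The complement of an implication set for `C k` is exactly `⋃ i, (C k i)ᶜ ×ˢ E i`, so the
lower-class pieces glue one `k` at a time. -/
theorem IsAdditiveClass.iUnion_prod_of_locallyFinite {X Y ι : Type*} [TopologicalSpace X]
    [PseudoEMetricSpace Y] {E : ι → Set Y} (hE : ∀ i, IsClosed (E i)) (hlf : LocallyFinite E)
    (hdisj : Pairwise fun i j => Disjoint (E i) (E j)) {α : Ordinal.{0}} (hα0 : α ≠ 0)
    (hα : α < Ordinal.omega 1) {A : ι → Set X} (hA : ∀ i, IsAdditiveClass α (A i)) :
    IsAdditiveClass α (⋃ i, A i ×ˢ E i) := by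
  obtain ⟨C, hC, hAC⟩ := exists_uniform_iUnion_compl hα0 hA
  have := Ordinal.countable_Iio_of_lt_omega_one hα
  have : Nonempty (Iio α) := ⟨⟨0, pos_iff_ne_zero.2 hα0⟩⟩
  have key : ⋃ i, A i ×ˢ E i =
      ⋃ k : Iio α × ℕ, {p : X × Y | ∀ i, p.2 ∈ E i → p.1 ∈ C k i}ᶜ := by
    ext ⟨x, y⟩
    simp only [mem_iUnion, mem_prod, hAC, mem_compl_iff, mem_ofPred_eq, not_forall]
    constructor
    · rintro ⟨i, ⟨k, hk⟩, hi⟩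
      exact ⟨k, i, hi, hk⟩
    · rintro ⟨k, i, hi, hk⟩
      exact ⟨i, ⟨k, hk⟩, hi⟩
  rw [key]
  exact iUnion_compl_of_countable (fun k => k.1.2) fun k =>
    setOf_forall_mem_imp hE hlf hdisj (lt_trans k.1.2 hα) (hC k)

theorem locallyFinite_of_le_dist {Y ι : Type*} [PseudoMetricSpace Y] {E : ι → Set Y} {δ : ℝ}
    (hδ : 0 < δ) (hE : ∀ i j, i ≠ j → ∀ y ∈ E i, ∀ z ∈ E j, δ ≤ dist y z) : LocallyFinite E := by
  refine fun y => ⟨Metric.ball y (δ / 2), Metric.ball_mem_nhds y (half_pos hδ), ?_⟩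
  refine Set.Subsingleton.finite ?_
  rintro i ⟨u, hu, huy⟩ j ⟨v, hv, hvy⟩
  by_contra hij
  have := hE i j hij u hu v hv
  have := dist_triangle_right u v y
  rw [Metric.mem_ball] at huy hvy
  linarith

/-! ### Exhaustion and discrete refinement. -/

/-- If every nonempty closed set has a relatively open nonempty subset with a property `P`, then
the space is covered by a transfinite sequence of differences of open sets with property `P`. -/
theorem exists_wellOrdered_open_cover.{u} {Y : Type u} [TopologicalSpace Y] {P : Set Y → Prop}
    (h : ∀ F : Set Y, IsClosed F → F.Nonempty → ∃ U, IsOpen U ∧ (F ∩ U).Nonempty ∧ P (F ∩ U)) :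
    ∃ U : Ordinal.{u} → Set Y, (∀ ξ, IsOpen (U ξ)) ∧ (⋃ ξ, U ξ) = univ ∧
      ∀ ξ, (U ξ \ ⋃ ζ < ξ, U ζ).Nonempty → P (U ξ \ ⋃ ζ < ξ, U ζ) := by
  classical
  choose! V hV using h
  let step (F : Set Y) : Set Y := if IsClosed F ∧ F.Nonempty then V F else ∅
  let U : Ordinal.{u} → Set Y :=
    WellFoundedLT.fix fun ξ ih => step (⋃ ζ, ⋃ h : ζ < ξ, ih ζ h)ᶜ
  have hUeq (ξ) : U ξ = step (⋃ ζ < ξ, U ζ)ᶜ := WellFoundedLT.fix_eq _ ξ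
  have hstep (F : Set Y) : IsOpen (step F) := by
    dsimp only [step]
    split_ifs with hF
    · exact (hV F hF.1 hF.2).1
    · exact isOpen_empty
  have hUo (ξ) : IsOpen (U ξ) := hUeq ξ ▸ hstep _
  have hcl (ξ) : IsClosed (⋃ ζ < ξ, U ζ)ᶜ :=
    (isOpen_biUnion fun ζ _ => hUo ζ).isClosed_compl
  have hdiff (ξ) : U ξ \ ⋃ ζ < ξ, U ζ = (⋃ ζ < ξ, U ζ)ᶜ ∩ U ξ := by
    rw [sdiff_eq, inter_comm]
  have hgood (ξ) (hne : (⋃ ζ < ξ, U ζ)ᶜ.Nonempty) :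
      (U ξ \ ⋃ ζ < ξ, U ζ).Nonempty ∧ P (U ξ \ ⋃ ζ < ξ, U ζ) := by
    have hUV : U ξ = V (⋃ ζ < ξ, U ζ)ᶜ := (hUeq ξ).trans (if_pos ⟨hcl ξ, hne⟩)
    rw [hdiff, hUV]
    exact (hV _ (hcl ξ) hne).2
  refine ⟨U, hUo, ?_, fun ξ hξ => (hgood ξ (hξ.mono (sdiff_subset_compl _ _))).2⟩
  by_contra hcov
  obtain ⟨y, hy⟩ := (ne_univ_iff_exists_notMem _).1 hcov
  -- If a point is never covered, every stage adds a new point, which would inject the ordinals into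
  -- `Y`.
  have hne (ξ) : (⋃ ζ < ξ, U ζ)ᶜ.Nonempty :=
    ⟨y, fun hyξ => hy (iUnion₂_subset (fun ζ _ => subset_iUnion U ζ) hyξ)⟩
  choose c hc using fun ξ => (hgood ξ (hne ξ)).1
  refine not_injective_of_ordinal c fun ξ ζ hξζ => ?_
  rcases lt_trichotomy ξ ζ with hlt | heq | hlt
  · exact absurd (mem_biUnion hlt (hξζ ▸ (hc ξ).1)) (hc ζ).2
  · exact heq
  · exact absurd (mem_biUnion hlt (hξζ ▸ (hc ζ).1)) (hc ξ).2

/-- The differences of a well-ordered family of open sets decompose into countably many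
uniformly discrete families of closed sets. -/
theorem exists_discrete_refinement {Y ι : Type*} [PseudoMetricSpace Y] [LinearOrder ι]
    [WellFoundedLT ι] {U : ι → Set Y} (hU : ∀ i, IsOpen (U i)) (hcov : (⋃ i, U i) = univ) :
    ∃ E : ℕ → ι → Set Y, (∀ n i, IsClosed (E n i)) ∧ (∀ n, LocallyFinite (E n)) ∧
      (∀ n, Pairwise fun i j => Disjoint (E n i) (E n j)) ∧
      (∀ n i, E n i ⊆ U i \ ⋃ j < i, U j) ∧ ∀ y, ∃ n i, y ∈ E n i := by
  -- `y` is at least `1 / (n + 1)` away from `(U i)ᶜ`, which contains every point first covered at a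
  -- later index.
  have hsep (n : ℕ) (i j : ι) (hij : i < j) (y z : Y)
      (hy : y ∉ Metric.thickening (1 / (n + 1 : ℝ)) (U i)ᶜ) (hz : z ∉ ⋃ k < j, U k) :
      1 / (n + 1 : ℝ) ≤ dist y z := by
    by_contra! hlt
    exact hy (Metric.mem_thickening_iff.2 ⟨z, fun hzi => hz (mem_biUnion hij hzi), hlt⟩)
  have hsep' (n : ℕ) (i j : ι) (hij : i ≠ j) (y)
      (hy : y ∈ (Metric.thickening (1 / (n + 1 : ℝ)) (U i)ᶜ)ᶜ \ ⋃ k < i, U k) (z)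
      (hz : z ∈ (Metric.thickening (1 / (n + 1 : ℝ)) (U j)ᶜ)ᶜ \ ⋃ k < j, U k) :
      1 / (n + 1 : ℝ) ≤ dist y z := by
    rcases hij.lt_or_gt with hlt | hlt
    · exact hsep n i j hlt y z hy.1 hz.2
    · exact dist_comm z y ▸ hsep n j i hlt z y hz.1 hy.2
  have hpos (n : ℕ) : 0 < 1 / (n + 1 : ℝ) := Nat.one_div_pos_of_nat
  refine ⟨fun n i => (Metric.thickening (1 / (n + 1 : ℝ)) (U i)ᶜ)ᶜ \ ⋃ j < i, U j,
    fun n i => ?_, fun n => locallyFinite_of_le_dist (hpos n) (hsep' n),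
    fun n i j hij => ?_, fun n i => ?_, fun y => ?_⟩
  · exact Metric.isOpen_thickening.isClosed_compl.sdiff (isOpen_biUnion fun j _ => hU j)
  · refine Set.disjoint_left.2 fun y hyi hyj => ?_
    have := hsep' n i j hij y hyi y hyj
    rw [dist_self] at this
    exact absurd this (hpos n).not_ge
  · refine sdiff_subset_sdiff_left ?_
    rw [compl_subset_comm]
    exact Metric.self_subset_thickening (hpos n) _
  · have hex : {i | y ∈ U i}.Nonempty := by
      exact mem_iUnion.1 (hcov.symm.subset (mem_univ y))
    have hmin := wellFounded_lt.min_mem {i | y ∈ U i} hex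
    set i := wellFounded_lt.min {i | y ∈ U i} hex
    obtain ⟨ε, hε, hball⟩ := Metric.isOpen_iff.1 (hU i) y hmin
    obtain ⟨n, hn⟩ := exists_nat_one_div_lt hε
    refine ⟨n, i, fun hy => ?_, fun hy => ?_⟩
    · obtain ⟨z, hz, hyz⟩ := Metric.mem_thickening_iff.1 hy
      exact hz (hball (Metric.mem_ball'.2 (hyz.trans hn)))
    · obtain ⟨j, hj, hyj⟩ := mem_iUnion₂.1 hy
      exact wellFounded_lt.not_lt_min {i | y ∈ U i} hyj hj

/-! ### Uniform approximation and conclusion. -/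

/-- Borel class is preserved by uniform limits. -/
theorem IsOfBorelClass.of_uniform_approx {X Z : Type*} [TopologicalSpace X] [PseudoMetricSpace Z]
    {α : Ordinal.{0}} {f : X → Z}
    (h : ∀ ε > 0, ∃ g : X → Z, IsOfBorelClass α g ∧ ∀ x, dist (f x) (g x) ≤ ε) :
    IsOfBorelClass α f := by
  intro W hW
  have hpos (n : ℕ) : 0 < 1 / (n + 1 : ℝ) := Nat.one_div_pos_of_nat
  choose g hg hfg using fun n : ℕ => h (1 / (n + 1 : ℝ)) (hpos n)
  -- Shrinking `W` by the approximation error forces `f x ∈ W`; the closed thickening keeps the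
  -- shrunken set open.
  have key : f ⁻¹' W = ⋃ n, g n ⁻¹' (Metric.cthickening (1 / (n + 1 : ℝ)) Wᶜ)ᶜ := by
    ext x
    rw [mem_iUnion]
    constructor
    · intro hx
      obtain ⟨ε, hε, hball⟩ := Metric.isOpen_iff.1 hW (f x) hx
      obtain ⟨n, hn⟩ := exists_nat_one_div_lt (half_pos hε)
      refine ⟨n, fun hmem => ?_⟩
      obtain ⟨z, hz, hgz⟩ := Metric.mem_thickening_iff.1
        (Metric.cthickening_subset_thickening' (half_pos hε) hn _ hmem)
      refine hz (hball ?_)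
      have := dist_triangle (f x) (g n x) z
      have := hfg n x
      rw [Metric.mem_ball']
      linarith
    · rintro ⟨n, hn⟩
      by_contra hx
      exact hn (Metric.mem_cthickening_of_dist_le _ _ _ _ hx (dist_comm (f x) _ ▸ hfg n x))
  rw [key]
  exact IsAdditiveClass.iUnion fun n => hg n _ Metric.isClosed_cthickening.isOpen_compl

theorem HasPECP.exists_isOpen_dist_le {X Y Z : Type*} [TopologicalSpace Y] [MetricSpace Z]
    {f : X × Y → Z} (hx : HasPECP (range fun (x : X) (y : Y) => f (x, y))) {ε : ℝ} (hε : 0 < ε)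
    {F : Set Y} (hF : IsClosed F) (hne : F.Nonempty) :
    ∃ U, IsOpen U ∧ (F ∩ U).Nonempty ∧
      ∀ y ∈ F ∩ U, ∀ z ∈ F ∩ U, ∀ x, dist (f (x, y)) (f (x, z)) ≤ ε := by
  obtain ⟨y, hy⟩ := hx F hF hne
  have hev := hy _ (Metric.dist_mem_uniformity (half_pos hε))
  rw [nhds_subtype, eventually_comap] at hev
  obtain ⟨U, hU, hUo, hyU⟩ := eventually_nhds_iff.1 hev
  have hdist (z) (hz : z ∈ F ∩ U) (x : X) : dist (f (x, y)) (f (x, z)) < ε / 2 :=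
    hU z hz.2 ⟨z, hz.1⟩ rfl ⟨_, _, ⟨x, rfl⟩, rfl⟩
  refine ⟨U, hUo, ⟨y, y.2, hyU⟩, fun z hz w hw x => ?_⟩
  have := dist_triangle_left (f (x, z)) (f (x, w)) (f (x, y))
  have := hdist z hz x
  have := hdist w hw x
  linarith

theorem mainTheorem2 {X Y Z : Type*} [MetricSpace X] [MetricSpace Y] [MetricSpace Z]
    (α : Ordinal.{0}) (hα : 1 ≤ α) (hα' : α < Ordinal.omega 1) (f : X × Y → Z)
    (hx : HasPECP (Set.range fun (x : X) (y : Y) => f (x, y)))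
    (hy : ∀ y : Y, IsOfBorelClass α fun x : X => f (x, y)) :
    IsOfBorelClass α f := by
  have hα0 : α ≠ 0 := (zero_lt_one.trans_le hα).ne'
  refine IsOfBorelClass.of_uniform_approx fun ε hε => ?_
  obtain ⟨U, hU, hcov, hosc⟩ := exists_wellOrdered_open_cover
    (P := fun D => ∀ y ∈ D, ∀ z ∈ D, ∀ x, dist (f (x, y)) (f (x, z)) ≤ ε)
    fun F hF hne => hx.exists_isOpen_dist_le hε hF hne
  obtain ⟨E, hE, hlf, hdisj, hEU, hEcov⟩ := exists_discrete_refinement hU hcov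
  have hmem (y : Y) : ∃ ξ, y ∈ U ξ \ ⋃ ζ < ξ, U ζ := by
    obtain ⟨n, i, hi⟩ := hEcov y
    exact ⟨i, hEU n i hi⟩
  have huniq (y : Y) (ξ ζ) (hξ : y ∈ U ξ \ ⋃ i < ξ, U i) (hζ : y ∈ U ζ \ ⋃ i < ζ, U i) :
      ξ = ζ := by
    rcases lt_trichotomy ξ ζ with hlt | heq | hlt
    · exact absurd (mem_biUnion hlt hξ.1) hζ.2
    · exact heq
    · exact absurd (mem_biUnion hlt hζ.1) hξ.2
  choose r hr using hmem
  rcases isEmpty_or_nonempty Y with hY | hY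
  · refine ⟨f, fun W _ => ?_, fun p => isEmptyElim p.2⟩
    rw [eq_univ_of_forall (s := f ⁻¹' W) fun p => isEmptyElim p.2]
    exact IsAdditiveClass.univ α
  -- Empty differences get an arbitrary point, never used since `r` selects only nonempty ones.
  have hpoint (ξ) : ∃ c : Y, (U ξ \ ⋃ i < ξ, U i).Nonempty → c ∈ U ξ \ ⋃ i < ξ, U i := by
    by_cases hne : (U ξ \ ⋃ i < ξ, U i).Nonempty
    · exact ⟨hne.some, fun _ => hne.some_mem⟩
    · exact ⟨Classical.arbitrary Y, fun h => absurd h hne⟩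
  choose c hc using hpoint
  refine ⟨fun p => f (p.1, c (r p.2)), fun W hW => ?_, fun p => ?_⟩
  · have key : (fun p : X × Y => f (p.1, c (r p.2))) ⁻¹' W =
        ⋃ n, ⋃ ξ, ((fun x => f (x, c ξ)) ⁻¹' W) ×ˢ E n ξ := by
      ext ⟨x, y⟩
      simp only [mem_preimage, mem_iUnion, mem_prod]
      constructor
      · intro h
        obtain ⟨n, i, hi⟩ := hEcov y
        exact ⟨n, i, huniq y _ _ (hr y) (hEU n i hi) ▸ h, hi⟩
      · rintro ⟨n, i, h, hi⟩
        exact huniq y _ _ (hr y) (hEU n i hi) ▸ h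
    rw [key]
    exact IsAdditiveClass.iUnion fun n =>
      IsAdditiveClass.iUnion_prod_of_locallyFinite (hE n) (hlf n) (hdisj n) hα0 hα'
        fun ξ => hy (c ξ) W hW
  · have hne : (U (r p.2) \ ⋃ i < r p.2, U i).Nonempty := ⟨p.2, hr p.2⟩
    exact hosc _ hne _ (hr p.2) _ (hc _ hne) p.1
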